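/- **Pointwise asymptotic normality of the coefficient estimator.** *Model.* For individuals $i=1,2,\dots$ and periods $t=1,2,\dots$ let $Y_{it}=X_{it}'\beta(U_i)+V_{it}$, where $X_{it}\in\mathbb R^K$ and $Y_{it}\in\mathbb R$ are observed, and $\beta=(\beta_1,\dots,\beta_K)'\colon\mathbb R\to\mathbb R^K$ is deterministic. *Estimator.* From a sample of $n$ individuals and $T$ periods let $\hat\beta_T(U_i)=\bigl(\frac1T\sum_{t\le T}X_{it}X_{it}'\bigr)^{-1}\bigl(\frac1T\sum_{t\le T}X_{it}Y_{it}\bigr)$ be the time-series OLS estimator of individual $i$. For a fixed vector $x^*\in\mathbb R^K$ let $\hat Y_i^*=x^{*\prime}\hat\beta_T(U_i)$, and let $\hat\sigma$ be a (measurably chosen) permutation of $\{1,\dots,n\}$ with $\hat Y^*_{\hat\sigma(1)}\le\dots\le\hat Y^*_{\hat\sigma(n)}$, ties being broken by any rule. For $\tau\in(0,1)$ put $\hat\beta(\tau)=\hat\beta_T\bigl(U_{\hat\sigma(\lceil n\tau\rceil)}\bigr)$. *Assumptions.* 1. For every $T$, the observables $\bigl((Y_{it})_{t\le T},(X_{it})_{t\le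 T}\bigr)$ are iid across $i$. 2. The ranks $U_i$ are iid and uniform on $(0,1)$. 3. $x^*$ is in the support of $X_{it}$ (for each $i$, for some $t$), and $g(u)=x^{*\prime}\beta(u)$ is strictly increasing on $[0,1]$ and continuous on $(0,1)$. 4. Conditionally on individual $i$ (that is, given some random element $A_i$ of which $U_i$ is almost surely a measurable function), for each $t$: the $K$ regressors are not perfectly multicollinear, $E(X_{it}V_{it})=0$, and $\beta(U_i)$ is identified as $[E(X_{it}X_{it}')]^{-1}E(X_{it}Y_{it})$. 5. Each $\beta_k$ is uniformly continuous on $(0,1)$. 6. $g$ is differentiable on $(0,1)$ with $g'\ge L$ there for some constant $L>0$. 7. There are $\kappa>0$, $T_0\in\mathbb N$ and $M<\infty$ with $E\bigl(T^{\kappa}\|\hat\beta_T(U_i)-\beta(U_i)\|\bigr)\le M$ for all $T>T_0$ and all $i$. 8. Each $\beta_k$ is differentiable on $(0,1)$ with uniformly continuous and bounded derivative. 9. $n\to\infty$ and $T\to\infty$ along any sequence of sample sizes with $n=o\bigl(T^{\kappa/(3+\delta)}\bigr)$ for some $\delta>0$, and along this sequence $P\bigl(\sup_{1\le i\le n}\|\hat\beta_T(U_i)-\beta(U_i)\|>\varepsilon\bigr)\to0$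 for every $\varepsilon>0$. *Conclusion.* For every $\tau\in(0,1)$ and every $k\in\{1,\dots,K\}$, along this sequence $$\sqrt n\,\bigl(\hat\beta_k(\tau)-\beta_k(\tau)\bigr)\xrightarrow{d}N\bigl(0,\ \tau(1-\tau)\,(\beta_k'(\tau))^2\bigr),$$ and for every standard Brownian bridge $\mathbb G$ on $[0,1]$ the limit is the law of $\beta_k'(\tau)\,\mathbb G(\tau)$. -/

import Mathlib

open MeasureTheory ProbabilityTheory Filter Topology Set Asymptotics
open scoped ENNReal NNReal Matrix

noncomputable section

namespace PanelQuantile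

/-- Time-series OLS estimator of individual `i`'s coefficient vector, from the first `T` periods:
`(T⁻¹ ∑ₜ Xᵢₜ Xᵢₜ')⁻¹ (T⁻¹ ∑ₜ Xᵢₜ Yᵢₜ)`.  (It is `0` if the Gram matrix is singular.) -/
def tsOLS {Ω : Type*} {K : ℕ} (X : ℕ → ℕ → Ω → Fin K → ℝ) (Y : ℕ → ℕ → Ω → ℝ)
    (T i : ℕ) (ω : Ω) : Fin K → ℝ :=
  ((T : ℝ)⁻¹ • ∑ t ∈ Finset.range T, Matrix.vecMulVec (X i t ω) (X i t ω))⁻¹ *ᵥ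
    ((T : ℝ)⁻¹ • ∑ t ∈ Finset.range T, Y i t ω • X i t ω)

/-- Fitted outcome of individual `i` at the point `x*`. -/
def fittedOutcome {Ω : Type*} {K : ℕ} (X : ℕ → ℕ → Ω → Fin K → ℝ) (Y : ℕ → ℕ → Ω → ℝ)
    (xstar : Fin K → ℝ) (T i : ℕ) (ω : Ω) : ℝ :=
  xstar ⬝ᵥ tsOLS X Y T i ω

/-- `σ n T ω` is an estimated permutation of the first `n` individuals: it lists them in increasing
order of their fitted outcomes, and it is a random variable.  Ties may be broken by any rule. -/
structure IsEstimatedPermutation {Ω : Type*} [MeasurableSpace Ω] {K : ℕ}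
    (X : ℕ → ℕ → Ω → Fin K → ℝ) (Y : ℕ → ℕ → Ω → ℝ) (xstar : Fin K → ℝ)
    (σ : (n : ℕ) → ℕ → Ω → Equiv.Perm (Fin n)) : Prop where
  sorted : ∀ n T ω, Monotone fun k : Fin n => fittedOutcome X Y xstar T (σ n T ω k) ω
  measurable : ∀ n T (p : Equiv.Perm (Fin n)), MeasurableSet {ω | σ n T ω = p}

/-- The estimator of the coefficient vector at rank `τ`: the OLS estimate of the individual whose
fitted outcome has (one-based) position `⌈n τ⌉` in increasing order.  For `τ ∈ (0,1)` and `1 ≤ n`,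
`1 ≤ ⌈n τ⌉ ≤ n`, so that the first branch is the one taken. -/
def rankEstimator {Ω : Type*} {K : ℕ} (X : ℕ → ℕ → Ω → Fin K → ℝ) (Y : ℕ → ℕ → Ω → ℝ)
    (σ : (n : ℕ) → ℕ → Ω → Equiv.Perm (Fin n)) (n T : ℕ) (τ : ℝ) (ω : Ω) : Fin K → ℝ :=
  if h : ⌈(n : ℝ) * τ⌉₊ - 1 < n then
    tsOLS X Y T (σ n T ω ⟨⌈(n : ℝ) * τ⌉₊ - 1, h⟩ : Fin n) ω
  else 0

/-- The observables `(Yᵢ, Xᵢ)` of the individuals over the first `T` periods are iid over `i`,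
for every `T`. -/
def IIDObservables {Ω : Type*} [MeasurableSpace Ω] {K : ℕ} (μ : Measure Ω)
    (X : ℕ → ℕ → Ω → Fin K → ℝ) (Y : ℕ → ℕ → Ω → ℝ) : Prop :=
  ∀ T : ℕ,
    iIndepFun (fun (i : ℕ) (ω : Ω) (t : Fin T) => (Y i t ω, X i t ω)) μ ∧
    ∀ i j : ℕ, IdentDistrib (fun (ω : Ω) (t : Fin T) => (Y i t ω, X i t ω))
      (fun (ω : Ω) (t : Fin T) => (Y j t ω, X j t ω)) μ μ

/-- The ranks `Uᵢ` are iid and uniform on `(0,1)`. -/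
def IIDUniformRanks {Ω : Type*} [MeasurableSpace Ω] (μ : Measure Ω) (U : ℕ → Ω → ℝ) : Prop :=
  iIndepFun U μ ∧ ∀ i, pdf.IsUniform (U i) (Ioo (0 : ℝ) 1) μ volume

/-- For one period of one fixed individual, with `Q` the joint law of the regressors and the
disturbance `(X, V)` and with outcome `Y = X'b + V`: there is no perfect multicollinearity, `V` is
the linear projection error, and `b` is identified as `E[X X']⁻¹ E[X Y]`. -/
structure IsIdentifiedSlope {K : ℕ} (Q : Measure ((Fin K → ℝ) × ℝ)) (b : Fin K → ℝ) : Prop where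
  integrable_regressors : ∀ j l : Fin K, Integrable (fun z => z.1 j * z.1 l) Q
  integrable_error : ∀ j : Fin K, Integrable (fun z => z.1 j * z.2) Q
  no_multicollinearity : ∀ c : Fin K → ℝ, (∀ᵐ z ∂Q, c ⬝ᵥ z.1 = 0) → c = 0
  projection_error : ∀ j : Fin K, ∫ z, z.1 j * z.2 ∂Q = 0
  identified :
    IsUnit (Matrix.of fun j l : Fin K => ∫ z, z.1 j * z.1 l ∂Q).det ∧
    b = (Matrix.of fun j l : Fin K => ∫ z, z.1 j * z.1 l ∂Q)⁻¹ *ᵥ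
      fun j => ∫ z, z.1 j * (z.1 ⬝ᵥ b + z.2) ∂Q

/-- Individual slope identification.  `A i` collects what is held fixed when one conditions on
individual `i`; it determines the rank `U i` (so `A = U` is allowed), and for almost every value
`a` of `A i` the slope is identified from the conditional law of `(X i t, V i t)` given `A i = a`,
in every period `t`. -/
def IndividualSlopeIdentification {Ω 𝒜 : Type*} [MeasurableSpace Ω] [MeasurableSpace 𝒜] {K : ℕ}
    (μ : Measure Ω) [IsFiniteMeasure μ] (X : ℕ → ℕ → Ω → Fin K → ℝ) (V : ℕ → ℕ → Ω → ℝ)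
    (U : ℕ → Ω → ℝ) (β : ℝ → Fin K → ℝ) (A : ℕ → Ω → 𝒜) : Prop :=
  ∀ i : ℕ, ∃ r : 𝒜 → ℝ, Measurable r ∧ (∀ᵐ ω ∂μ, U i ω = r (A i ω)) ∧
    ∀ t : ℕ, ∀ᵐ a ∂(μ.map (A i)),
      IsIdentifiedSlope (condDistrib (fun ω => (X i t ω, V i t ω)) (A i) μ a) (β (r a))

/-- Along the sample sizes `(n m, T m)`, the OLS estimators of the first `n m` individuals are
uniformly consistent (in the supremum norm of `ℝᴷ`). -/
def OLSUniformConsistency {Ω : Type*} [MeasurableSpace Ω] {K : ℕ} (μ : Measure Ω)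
    (X : ℕ → ℕ → Ω → Fin K → ℝ) (Y : ℕ → ℕ → Ω → ℝ) (U : ℕ → Ω → ℝ) (β : ℝ → Fin K → ℝ)
    (n T : ℕ → ℕ) : Prop :=
  ∀ ε : ℝ, 0 < ε →
    Tendsto (fun m => μ {ω | ε < ⨆ i : Fin (n m), ‖tsOLS X Y (T m) i ω - β (U i ω)‖})
      atTop (𝓝 0)

/-- The scaled first moments `E (T ^ κ ‖β̂_T(Uᵢ) - β(Uᵢ)‖)` are bounded, for all `T > T₀`. -/
def OLSMomentBound {Ω : Type*} [MeasurableSpace Ω] {K : ℕ} (μ : Measure Ω)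
    (X : ℕ → ℕ → Ω → Fin K → ℝ) (Y : ℕ → ℕ → Ω → ℝ) (U : ℕ → Ω → ℝ) (β : ℝ → Fin K → ℝ)
    (κ : ℝ) : Prop :=
  ∃ (T₀ : ℕ) (M : ℝ≥0), ∀ T : ℕ, T₀ < T → ∀ i : ℕ,
    ∫⁻ ω, ENNReal.ofReal ((T : ℝ) ^ κ * ‖tsOLS X Y T i ω - β (U i ω)‖) ∂μ ≤ M

/-- A real function with a derivative on `(0,1)` that is uniformly continuous and bounded there. -/
def HasUnifContBddDeriv (f : ℝ → ℝ) : Prop :=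
  (∀ u ∈ Ioo (0 : ℝ) 1, DifferentiableAt ℝ f u) ∧
  UniformContinuousOn (deriv f) (Ioo 0 1) ∧
  ∃ C : ℝ, ∀ u ∈ Ioo (0 : ℝ) 1, |deriv f u| ≤ C

/-- Standard Brownian bridge on `[0,1]`. -/
structure IsStandardBrownianBridge {Ω : Type*} [MeasurableSpace Ω]
    (G : Icc (0 : ℝ) 1 → Ω → ℝ) (P : Measure Ω) : Prop where
  gaussian : IsGaussianProcess G P
  mean_zero : ∀ u, ∫ ω, G u ω ∂P = 0
  cov : ∀ u v : Icc (0 : ℝ) 1, covariance (G u) (G v) P = min (u : ℝ) v - (u : ℝ) * v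
  continuous_paths : ∀ᵐ ω ∂P, Continuous fun u => G u ω

end PanelQuantile

end

/-!
The proof is a Bahadur representation followed by the delta method.

Write `d i` for the norm of `β̂_T(U i) - β(U i)` and `D` for the sum of the `d i` over the sample.
The moment bound and Markov's inequality give `P(√n D ≥ ε) ≤ C n ^ (3 / 2) T ^ (-κ) / ε`, which
vanishes under the rate relation, so all individual coefficients, and with them all fitted outcomes,
are known up to `o(1 / √n)` in probability (`tendstoInMeasure_sqrt_mul_sum`).  As `x*'β` has slope
at least `L > 0`, sorting by fitted outcomes sorts the ranks up to an error of order `D`: the rank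
`v` of the selected individual has at least `n τ` ranks below `v + c D` and at most `n τ` below
`v - c D` (`isApproxQuantile_of_monotone`).

Such an approximate quantile satisfies `√n (v - τ) = -√n (Fₙ τ - τ) + o(1)` in probability, where
`Fₙ` is the empirical distribution function of the ranks
(`IIDUniformRanks.tendstoInMeasure_approxQuantile`).  By Chebyshev's inequality the empirical
process `√n (Fₙ - id)` varies by `o(1)` over any finite grid of mesh `η / √n` around `τ`; the
position of `v` relative to the grid points then pins down `√n (v - τ)` up to a multiple of `η`.

Differentiability of `β_k` at `τ` turns this into an asymptotically linear form of the rank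
estimator (`tendstoInMeasure_rankEstimator_add`), and the central limit theorem for the indicators
of `U i ≤ τ` with Slutsky's theorem gives the normal limit.  A Brownian bridge at `τ` is centred
normal with variance `τ (1 - τ)`, hence the second description of the limit.
-/

namespace PanelQuantile

/-! ### The uniform empirical process -/

/-- The uniform empirical process `√n (Fₙ b - b)` of the points `u 0, …, u (n - 1)`, where `Fₙ` is
their empirical distribution function.  It is `0` for `n = 0`. -/
noncomputable def empiricalDeviation (n : ℕ) (u : ℕ → ℝ) (b : ℝ) : ℝ :=
  (√(n : ℝ))⁻¹ * (∑ i ∈ Finset.range n, (Iic b).indicator 1 (u i) - n * b)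

section Uniform

variable {Ω : Type*} [MeasurableSpace Ω] {μ : Measure Ω} {U : ℕ → Ω → ℝ}

lemma IIDUniformRanks.map_eq (h : IIDUniformRanks μ U) (i : ℕ) :
    μ.map (U i) = volume.restrict (Ioo 0 1) := by
  have := h.2 i
  rw [pdf.IsUniform] at this
  simp [this, ProbabilityTheory.cond]

lemma IIDUniformRanks.aemeasurable (h : IIDUniformRanks μ U) (i : ℕ) : AEMeasurable (U i) μ :=
  (h.2 i).aemeasurable (by simp) (by simp)

lemma IIDUniformRanks.identDistrib (h : IIDUniformRanks μ U) (i j : ℕ) :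
    IdentDistrib (U i) (U j) μ μ :=
  ⟨h.aemeasurable i, h.aemeasurable j, by rw [h.map_eq, h.map_eq]⟩

lemma IIDUniformRanks.ae_mem (h : IIDUniformRanks μ U) (i : ℕ) : ∀ᵐ ω ∂μ, U i ω ∈ Ioo 0 1 := by
  apply ae_of_ae_map (h.aemeasurable i) (p := fun x => x ∈ Ioo (0 : ℝ) 1)
  rw [h.map_eq]
  exact ae_restrict_mem measurableSet_Ioo

lemma IIDUniformRanks.measureReal_preimage (h : IIDUniformRanks μ U) (i : ℕ) {A : Set ℝ}
    (hA : MeasurableSet A) : μ.real (U i ⁻¹' A) = volume.real (A ∩ Ioo 0 1) := by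
  rw [measureReal_def, ← Measure.map_apply_of_aemeasurable (h.aemeasurable i) hA, h.map_eq,
    Measure.restrict_apply hA, measureReal_def]

lemma IIDUniformRanks.measureReal_preimage_Iic (h : IIDUniformRanks μ U) (i : ℕ) {b : ℝ}
    (h0 : 0 ≤ b) (h1 : b < 1) : μ.real (U i ⁻¹' Iic b) = b := by
  rw [h.measureReal_preimage i measurableSet_Iic]
  have : Iic b ∩ Ioo 0 1 = Ioc 0 b := by ext; simp; grind
  simp [this, h0]

lemma IIDUniformRanks.measureReal_preimage_Ioc (h : IIDUniformRanks μ U) (i : ℕ) {a b : ℝ}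
    (h0 : 0 ≤ a) (hab : a ≤ b) (h1 : b < 1) : μ.real (U i ⁻¹' Ioc a b) = b - a := by
  rw [h.measureReal_preimage i measurableSet_Ioc]
  have : Ioc a b ∩ Ioo 0 1 = Ioc a b := by ext; simp; grind
  simp [this, hab]

lemma integral_indicator_comp {V : Ω → ℝ} (hV : AEMeasurable V μ) {A : Set ℝ}
    (hA : MeasurableSet A) : ∫ ω, (A.indicator (1 : ℝ → ℝ) ∘ V) ω ∂μ = μ.real (V ⁻¹' A) := by
  have := integral_map (μ := μ) hV (f := A.indicator (1 : ℝ → ℝ))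
    (measurable_one.indicator hA).aestronglyMeasurable
  simp only [Function.comp_apply]
  rw [← this, integral_indicator_one hA, measureReal_def, measureReal_def,
    Measure.map_apply_of_aemeasurable hV hA]

variable [IsProbabilityMeasure μ]

lemma memLp_indicator_comp {V : Ω → ℝ} (hV : AEMeasurable V μ) {A : Set ℝ}
    (hA : MeasurableSet A) (p : ℝ≥0∞) : MemLp (A.indicator (1 : ℝ → ℝ) ∘ V) p μ := by
  refine MemLp.of_bound (C := 1) ?_ ?_
  · exact ((measurable_one.indicator hA).comp_aemeasurable hV).aestronglyMeasurable
  · refine ae_of_all _ fun ω => ?_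
    by_cases h : V ω ∈ A <;> simp [h]

lemma variance_indicator_comp {V : Ω → ℝ} (hV : AEMeasurable V μ) {A : Set ℝ}
    (hA : MeasurableSet A) :
    Var[A.indicator (1 : ℝ → ℝ) ∘ V; μ] = μ.real (V ⁻¹' A) * (1 - μ.real (V ⁻¹' A)) := by
  have hsq : (A.indicator (1 : ℝ → ℝ) ∘ V) ^ 2 = A.indicator (1 : ℝ → ℝ) ∘ V := by
    ext ω
    by_cases h : V ω ∈ A <;> simp [h]
  rw [variance_eq_sub (memLp_indicator_comp hV hA 2), hsq, integral_indicator_comp hV hA]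
  ring

/-- Chebyshev's inequality for the centred and scaled number of the first `n` ranks in `A`. -/
lemma IIDUniformRanks.measure_centered_count_le (h : IIDUniformRanks μ U) {A : Set ℝ}
    (hA : MeasurableSet A) {p : ℝ} (hp : μ.real (U 0 ⁻¹' A) = p) (n : ℕ) {c : ℝ} (hc : 0 < c) :
    μ {ω | c ≤ |(√(n : ℝ))⁻¹ * (∑ i ∈ Finset.range n, A.indicator 1 (U i ω) - n * p)|} ≤
      ENNReal.ofReal (p / c ^ 2) := by
  rcases Nat.eq_zero_or_pos n with rfl | hn
  · simp [hc.not_ge]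
  have hs : 0 < √(n : ℝ) := by positivity
  set X : ℕ → Ω → ℝ := fun i => A.indicator 1 ∘ U i with hX
  have hp' : ∀ i, μ.real (U i ⁻¹' A) = p := fun i => by
    rw [← hp, h.measureReal_preimage i hA, h.measureReal_preimage 0 hA]
  have hmem : ∀ i, MemLp (X i) 2 μ := fun i => memLp_indicator_comp (h.aemeasurable i) hA 2
  have hint : μ[∑ i ∈ Finset.range n, X i] = n * p := by
    simp only [Finset.sum_apply]
    rw [integral_finsetSum _ fun i _ => (hmem i).integrable (by norm_num)]
    simp [hX, integral_indicator_comp (h.aemeasurable _) hA, hp', -Function.comp_apply]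
  have hvar : Var[∑ i ∈ Finset.range n, X i; μ] ≤ n * p := by
    rw [IndepFun.variance_sum fun i _ => hmem i]
    · refine (Finset.sum_le_card_nsmul _ _ p fun i _ => ?_).trans (by simp)
      rw [hX, variance_indicator_comp (h.aemeasurable _) hA, hp']
      have : 0 ≤ p := hp ▸ measureReal_nonneg
      nlinarith [sq_nonneg p]
    · intro i _ j _ hij
      exact (h.1.indepFun hij).comp (measurable_one.indicator hA) (measurable_one.indicator hA)
  have hch := meas_ge_le_variance_div_sq (c := c * √(n : ℝ))
    (memLp_finsetSum' (Finset.range n) fun i _ => hmem i) (by positivity)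
  rw [hint] at hch
  refine (measure_mono ?_).trans (hch.trans (ENNReal.ofReal_le_ofReal ?_))
  · intro ω hω
    simp only [mem_ofPred_eq, abs_mul, abs_inv, abs_of_pos hs] at hω
    simp only [mem_ofPred_eq, Finset.sum_apply, hX, Function.comp_apply]
    rwa [inv_mul_eq_div, le_div_iff₀ hs] at hω
  · rw [mul_pow, Real.sq_sqrt (by positivity), div_le_div_iff₀ (by positivity) (by positivity)]
    have : 0 < c ^ 2 := by positivity
    nlinarith

lemma IIDUniformRanks.measure_le_abs_empiricalDeviation (h : IIDUniformRanks μ U) (n : ℕ) {b : ℝ}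
    (hb : b ∈ Ioo (0 : ℝ) 1) {c : ℝ} (hc : 0 < c) :
    μ {ω | c ≤ |empiricalDeviation n (fun i => U i ω) b|} ≤ ENNReal.ofReal (b / c ^ 2) :=
  h.measure_centered_count_le measurableSet_Iic
    (h.measureReal_preimage_Iic 0 hb.1.le hb.2) n hc

/-- Increments of the empirical process over short intervals are small in probability. -/
lemma IIDUniformRanks.measure_le_abs_empiricalDeviation_sub (h : IIDUniformRanks μ U) (n : ℕ)
    {a b : ℝ} (ha : a ∈ Ioo (0 : ℝ) 1) (hb : b ∈ Ioo (0 : ℝ) 1) {c : ℝ} (hc : 0 < c) :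
    μ {ω | c ≤ |empiricalDeviation n (fun i => U i ω) b -
        empiricalDeviation n (fun i => U i ω) a|} ≤
      ENNReal.ofReal (|b - a| / c ^ 2) := by
  wlog hab : a ≤ b generalizing a b
  · simpa only [abs_sub_comm] using this hb ha (le_of_not_ge hab)
  rw [abs_of_nonneg (sub_nonneg.2 hab)]
  convert! h.measure_centered_count_le measurableSet_Ioc
    (h.measureReal_preimage_Ioc 0 ha.1.le hab hb.2) n hc using 5 with ω
  rw [empiricalDeviation, empiricalDeviation, ← mul_sub]
  congr 1
  have : ∀ x : ℝ, (Ioc a b).indicator (1 : ℝ → ℝ) x =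
      (Iic b).indicator 1 x - (Iic a).indicator 1 x := by
    intro x
    simp only [indicator_apply, mem_Ioc, mem_Iic, Pi.one_apply]
    grind
  simp only [this, Finset.sum_sub_distrib]
  ring

/-- The central limit theorem at a fixed argument of the empirical process. -/
lemma IIDUniformRanks.tendstoInDistribution_empiricalDeviation (h : IIDUniformRanks μ U) {b : ℝ}
    (hb : b ∈ Ioo (0 : ℝ) 1) {Ω' : Type*} [MeasurableSpace Ω'] {P : Measure Ω'}
    [IsProbabilityMeasure P] {G : Ω' → ℝ}
    (hG : HasLaw G (gaussianReal 0 (b * (1 - b)).toNNReal) P) :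
    TendstoInDistribution (fun (n : ℕ) ω => empiricalDeviation n (fun i => U i ω) b) atTop G
      (fun _ => μ) P := by
  have hm : Measurable ((Iic b).indicator (1 : ℝ → ℝ)) := measurable_one.indicator measurableSet_Iic
  have hb' := h.measureReal_preimage_Iic 0 hb.1.le hb.2
  have hint := integral_indicator_comp (h.aemeasurable 0) (measurableSet_Iic (a := b))
  have hclt := tendstoInDistribution_inv_sqrt_mul_sum_sub
    (X := fun i => (Iic b).indicator (1 : ℝ → ℝ) ∘ U i) (P := μ) (P' := P) (Y := G)
    (by rwa [variance_indicator_comp (h.aemeasurable 0) measurableSet_Iic, hb'])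
    (memLp_indicator_comp (h.aemeasurable 0) measurableSet_Iic 2)
    (h.1.comp _ fun _ => hm) (fun i => (h.identDistrib i 0).comp hm)
  rw [hint, hb'] at hclt
  exact hclt

end Uniform

/-! ### Bahadur representation of the selected rank -/

lemma le_sum_indicator_Iic {n : ℕ} {u : ℕ → ℝ} (σ : Equiv.Perm (Fin n)) (p : Fin n) {b : ℝ}
    (h : ∀ j ≤ p, u (σ j) ≤ b) :
    (p : ℝ) + 1 ≤ ∑ i ∈ Finset.range n, (Iic b).indicator (1 : ℝ → ℝ) (u i) := by
  rw [Finset.sum_range, ← Equiv.sum_comp σ]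
  calc (p : ℝ) + 1 = ∑ j ∈ Finset.Iic p, (1 : ℝ) := by simp
    _ ≤ ∑ j ∈ Finset.Iic p, (Iic b).indicator (1 : ℝ → ℝ) (u (σ j)) :=
      Finset.sum_le_sum fun j hj => by simp [h j (Finset.mem_Iic.1 hj)]
    _ ≤ _ := Finset.sum_le_univ_sum_of_nonneg fun j =>
      indicator_nonneg (fun _ _ => zero_le_one) _

lemma sum_indicator_Iic_le {n : ℕ} {u : ℕ → ℝ} (σ : Equiv.Perm (Fin n)) (p : Fin n) {a : ℝ}
    (h : ∀ j ≥ p, a < u (σ j)) :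
    ∑ i ∈ Finset.range n, (Iic a).indicator (1 : ℝ → ℝ) (u i) ≤ p := by
  rw [Finset.sum_range, ← Equiv.sum_comp σ]
  calc ∑ j, (Iic a).indicator (1 : ℝ → ℝ) (u (σ j))
      = ∑ j ∈ Finset.Iio p, (Iic a).indicator (1 : ℝ → ℝ) (u (σ j)) := by
        refine (Finset.sum_subset (Finset.subset_univ _) fun j _ hj => ?_).symm
        have := h j (not_lt.1 (by simpa using hj))
        simp [this]
    _ ≤ ∑ j ∈ Finset.Iio p, (1 : ℝ) := Finset.sum_le_sum fun j _ => by
        by_cases h : u (σ j) ≤ a <;> simp [h]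
    _ = p := by simp

/-- `v` is an approximate `τ`-quantile, up to `e`, of the points `u 0, …, u (n - 1)`.  The point in
position `⌈n τ⌉` in increasing order has this property with `e = 0`. -/
structure IsApproxQuantile (n : ℕ) (u : ℕ → ℝ) (τ v e : ℝ) : Prop where
  le_count : ∀ b, v + e ≤ b → n * τ ≤ ∑ i ∈ Finset.range n, (Iic b).indicator (1 : ℝ → ℝ) (u i)
  count_le : ∀ a, a < v - e → ∑ i ∈ Finset.range n, (Iic a).indicator (1 : ℝ → ℝ) (u i) ≤ n * τ

/-- The deterministic core of Bahadur's representation: if the empirical process varies by at most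
`η` over the grid `τ + j η / √n`, then the scaled deviation of an approximate quantile from `τ` is
minus the empirical process, up to `4 η`. -/
lemma IsApproxQuantile.abs_add_empiricalDeviation_le {n : ℕ} (hn : 0 < n) {u : ℕ → ℝ}
    {τ v e η : ℝ} (hη : 0 < η) (h : IsApproxQuantile n u τ v e) (he : √(n : ℝ) * e ≤ η) {J : ℤ}
    (hJ : |empiricalDeviation n u τ| / η + 4 ≤ J)
    (hgrid : ∀ j ∈ Finset.Icc (-J) J,
      |empiricalDeviation n u (τ + j * η / √(n : ℝ)) - empiricalDeviation n u τ| ≤ η) :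
    |√(n : ℝ) * (v - τ) + empiricalDeviation n u τ| ≤ 4 * η := by
  set z := empiricalDeviation n u τ
  set s := √(n : ℝ) with hs
  have hs0 : 0 < s := by positivity
  have hss : s * s = n := Real.mul_self_sqrt (by positivity)
  have hval : ∀ j : ℤ, empiricalDeviation n u (τ + j * η / s) =
      s⁻¹ * (∑ i ∈ Finset.range n, (Iic (τ + j * η / s)).indicator (1 : ℝ → ℝ) (u i) - n * τ)
        - j * η := by
    intro j
    rw [empiricalDeviation, ← hs]
    have : (n : ℝ) * (j * η / s) = s * (j * η) := by rw [← hss]; field_simp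
    rw [mul_add, this, ← sub_sub, mul_sub s⁻¹ _ (s * _), inv_mul_cancel_left₀ hs0.ne']
  have hfl := Int.floor_le (-z / η)
  have hlt := Int.lt_floor_add_one (-z / η)
  set f := ⌊-z / η⌋
  have hdiv : -z / η * η = -z := div_mul_cancel₀ _ hη.ne'
  have h1 : (f : ℝ) * η ≤ -z := by nlinarith
  have h2 : -z < (f : ℝ) * η + η := by nlinarith
  have hzabs : |-z / η| ≤ J - 4 := by rw [abs_div, abs_neg, abs_of_pos hη]; linarith
  obtain ⟨h3, h4⟩ := abs_le.1 hzabs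
  rw [abs_le]
  constructor
  · by_contra! hc
    -- `(f - 2) η` lies in `(-z - 3 η, -z - 2 η]`, hence above `√n (v + e - τ)`
    have hj : f - 2 ∈ Finset.Icc (-J) J := by
      rw [Finset.mem_Icc]
      constructor <;> rify <;> linarith
    have hr := hgrid _ hj
    rw [hval] at hr
    have hle := h.le_count (τ + (f - 2 : ℤ) * η / s) (by
      have : s * (v + e) ≤ s * (τ + (f - 2 : ℤ) * η / s) := by
        rw [mul_add s τ, mul_div_cancel₀ _ hs0.ne']
        push_cast
        nlinarith
      exact le_of_mul_le_mul_left this hs0)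
    have h5 := mul_nonneg (inv_pos.2 hs0).le (sub_nonneg.2 hle)
    have h6 := (abs_le.1 hr).2
    push_cast at h5 h6
    nlinarith
  · by_contra! hc
    -- `(f + 2) η` lies in `(-z + η, -z + 2 η]`, hence below `√n (v - e - τ)`
    have hj : f + 2 ∈ Finset.Icc (-J) J := by
      rw [Finset.mem_Icc]
      constructor <;> rify <;> linarith
    have hr := hgrid _ hj
    rw [hval] at hr
    have hle := h.count_le (τ + (f + 2 : ℤ) * η / s) (by
      have : s * (τ + (f + 2 : ℤ) * η / s) < s * (v - e) := by
        rw [mul_add s τ, mul_div_cancel₀ _ hs0.ne']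
        push_cast
        nlinarith
      exact lt_of_mul_lt_mul_left this hs0.le)
    have h5 := mul_nonneg (inv_pos.2 hs0).le (sub_nonneg.2 hle)
    have h6 := (abs_le.1 hr).1
    rw [mul_sub] at h5 h6
    push_cast at h5 h6
    nlinarith

section Bahadur

variable {Ω : Type*} [MeasurableSpace Ω] {μ : Measure Ω} [IsProbabilityMeasure μ] {U : ℕ → Ω → ℝ}

lemma IIDUniformRanks.exists_forall_measure_le (h : IIDUniformRanks μ U) {τ : ℝ}
    (hτ : τ ∈ Ioo (0 : ℝ) 1) {ρ : ℝ≥0∞} (hρ : 0 < ρ) :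
    ∃ M : ℝ, 0 < M ∧ ∀ n, μ {ω | M ≤ |empiricalDeviation n (fun i => U i ω) τ|} ≤ ρ := by
  have hlim : Tendsto (fun M : ℝ => ENNReal.ofReal (τ / M ^ 2)) atTop (𝓝 0) := by
    rw [← ENNReal.ofReal_zero]
    exact ENNReal.tendsto_ofReal (tendsto_const_nhds.div_atTop (tendsto_pow_atTop two_ne_zero))
  obtain ⟨M, hM, hM0⟩ :=
    ((ENNReal.tendsto_nhds_zero.1 hlim ρ hρ).and (eventually_gt_atTop 0)).exists
  exact ⟨M, hM0, fun n => (h.measure_le_abs_empiricalDeviation n hτ hM0).trans hM⟩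

lemma tendsto_sqrt_natCast_atTop {n : ℕ → ℕ} (hn : Tendsto n atTop atTop) :
    Tendsto (fun m => √(n m : ℝ)) atTop atTop :=
  Real.tendsto_sqrt_atTop.comp (tendsto_natCast_atTop_atTop.comp hn)

/-- Oscillation of the empirical process: its increment over an interval of length of order
`1 / √n` vanishes in probability. -/
lemma IIDUniformRanks.tendsto_measure_empiricalDeviation_sub (h : IIDUniformRanks μ U) {n : ℕ → ℕ}
    (hn : Tendsto n atTop atTop) {τ : ℝ} (hτ : τ ∈ Ioo (0 : ℝ) 1) (x : ℝ) {η : ℝ} (hη : 0 < η) :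
    Tendsto (fun m => μ {ω | η ≤ |empiricalDeviation (n m) (fun i => U i ω) (τ + x / √(n m : ℝ)) -
      empiricalDeviation (n m) (fun i => U i ω) τ|}) atTop (𝓝 0) := by
  have hx : Tendsto (fun m => x / √(n m : ℝ)) atTop (𝓝 0) :=
    tendsto_const_nhds.div_atTop (tendsto_sqrt_natCast_atTop hn)
  have hmem : ∀ᶠ m in atTop, τ + x / √(n m : ℝ) ∈ Ioo (0 : ℝ) 1 := by
    have : Tendsto (fun m => τ + x / √(n m : ℝ)) atTop (𝓝 τ) := by simpa using hx.const_add τ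
    exact this.eventually_mem (isOpen_Ioo.mem_nhds hτ)
  have hbd : Tendsto (fun m => ENNReal.ofReal (|x / √(n m : ℝ)| / η ^ 2)) atTop (𝓝 0) := by
    rw [← ENNReal.ofReal_zero]
    refine ENNReal.tendsto_ofReal ?_
    simpa using hx.abs.div_const (η ^ 2)
  refine tendsto_of_tendsto_of_tendsto_of_le_of_le' tendsto_const_nhds hbd
    (Eventually.of_forall fun _ => zero_le) ?_
  filter_upwards [hmem] with m hm
  simpa using h.measure_le_abs_empiricalDeviation_sub (n m) hτ hm hη

/-- **Bahadur's representation.** The scaled deviation from `τ` of an approximate `τ`-quantile of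
the ranks, with error `o(1 / √n)` in probability, is asymptotically minus the empirical process. -/
theorem IIDUniformRanks.tendstoInMeasure_approxQuantile (h : IIDUniformRanks μ U) {n : ℕ → ℕ}
    (hn : Tendsto n atTop atTop) {τ : ℝ} (hτ : τ ∈ Ioo (0 : ℝ) 1) {v e : ℕ → Ω → ℝ}
    (hq : ∀ m, 0 < n m → ∀ᵐ ω ∂μ, IsApproxQuantile (n m) (fun i => U i ω) τ (v m ω) (e m ω))
    (he : TendstoInMeasure μ (fun m ω => √(n m : ℝ) * e m ω) atTop 0) :
    TendstoInMeasure μ (fun m ω => √(n m : ℝ) * (v m ω - τ) +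
      empiricalDeviation (n m) (fun i => U i ω) τ) atTop 0 := by
  rw [tendstoInMeasure_iff_norm] at he ⊢
  intro ε hε
  rw [ENNReal.tendsto_nhds_zero]
  intro ρ hρ
  have hρ2 : 0 < ρ / 2 := ENNReal.half_pos hρ.ne'
  obtain ⟨M, hM0, hM⟩ := h.exists_forall_measure_le hτ hρ2
  -- the deterministic bound `4 η` has to stay strictly below `ε`
  set η := ε / 5 with hη
  have hη0 : 0 < η := by positivity
  set J : ℤ := ⌈M / η + 4⌉
  have hJ : M / η + 4 ≤ J := Int.le_ceil _
  have hsmall : Tendsto (fun m => (∑ j ∈ Finset.Icc (-J) J,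
      μ {ω | η ≤ |empiricalDeviation (n m) (fun i => U i ω) (τ + j * η / √(n m : ℝ)) -
        empiricalDeviation (n m) (fun i => U i ω) τ|}) +
      μ {ω | η ≤ ‖√(n m : ℝ) * e m ω - (0 : Ω → ℝ) ω‖}) atTop (𝓝 0) := by
    have h1 := tendsto_finsetSum (Finset.Icc (-J) J) fun j _ =>
      h.tendsto_measure_empiricalDeviation_sub hn hτ (j * η) hη0
    simpa using h1.add (he η hη0)
  filter_upwards [ENNReal.tendsto_nhds_zero.1 hsmall _ hρ2, hn.eventually_gt_atTop 0] with m hm hnm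
  rw [← ENNReal.add_halves ρ]
  refine le_trans ?_ (add_le_add (hM (n m)) hm)
  refine le_trans ?_ (add_le_add le_rfl (add_le_add (measure_biUnion_finset_le _ _) le_rfl))
  refine le_trans ?_ (add_le_add le_rfl (measure_union_le _ _))
  refine le_trans ?_ (measure_union_le _ _)
  refine measure_mono_ae ?_
  filter_upwards [hq m hnm] with ω hω
  intro (hbad : ε ≤ ‖_ - _‖)
  by_contra hgood
  change ω ∉ (_ ∪ (_ ∪ _) : Set Ω) at hgood
  simp only [mem_union, mem_iUnion, mem_ofPred_eq, not_or, not_exists, not_le, exists_prop,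
    not_and, Pi.zero_apply, sub_zero, Real.norm_eq_abs] at hgood hbad
  obtain ⟨hZ, hgrid, hE⟩ := hgood
  have := hω.abs_add_empiricalDeviation_le hnm hη0 ((le_abs_self _).trans hE.le) (J := J)
    (le_trans (by gcongr) hJ) fun j hj => (hgrid j hj).le
  linarith

end Bahadur

/-! ### The delta method in probability -/

/-- **Delta method**, for an estimator with a linear representation `r (v - τ) = -Z + o(1)` in which
`Z` is bounded in probability. -/
lemma tendstoInMeasure_delta {Ω : Type*} [MeasurableSpace Ω] {μ : Measure Ω} {r : ℕ → ℝ}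
    (hr : Tendsto r atTop atTop) {v Z : ℕ → Ω → ℝ} {f : ℝ → ℝ} {f' τ : ℝ}
    (hf : HasDerivAt f f' τ)
    (hZ : ∀ ρ : ℝ≥0∞, 0 < ρ → ∃ M : ℝ, 0 < M ∧ ∀ m, μ {ω | M ≤ |Z m ω|} ≤ ρ)
    (hv : TendstoInMeasure μ (fun m ω => r m * (v m ω - τ) + Z m ω) atTop 0) :
    TendstoInMeasure μ (fun m ω => r m * (f (v m ω) - f τ) + f' * Z m ω) atTop 0 := by
  rw [tendstoInMeasure_iff_norm] at hv ⊢
  intro ε hε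
  rw [ENNReal.tendsto_nhds_zero]
  intro ρ hρ
  have hρ2 : 0 < ρ / 2 := ENNReal.half_pos hρ.ne'
  obtain ⟨M, hM0, hM⟩ := hZ _ hρ2
  set c := ε / (2 * (M + 1)) with hc
  have hc0 : 0 < c := by positivity
  obtain ⟨d, hd0, hd⟩ := Metric.eventually_nhds_iff.1
    ((hasDerivAt_iff_isLittleO.1 hf).bound hc0)
  set η := min 1 (ε / (4 * (|f'| + 1))) with hη
  have hη0 : 0 < η := by positivity
  filter_upwards [ENNReal.tendsto_nhds_zero.1 (hv η hη0) _ hρ2, hr.eventually_gt_atTop 0,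
    hr.eventually_gt_atTop ((M + 1) / d)] with m hm hr0 hrd
  rw [← ENNReal.add_halves ρ]
  refine le_trans ((measure_mono ?_).trans (measure_union_le _ _)) (add_le_add (hM m) hm)
  intro ω hbad
  by_contra hgood
  simp only [mem_union, mem_ofPred_eq, not_or, not_le, Pi.zero_apply, sub_zero,
    Real.norm_eq_abs] at hgood hbad
  obtain ⟨hZω, hWω⟩ := hgood
  set w := v m ω - τ with hw
  set z := Z m ω
  have hrw : r m * |w| < M + 1 := by
    rw [← abs_of_pos hr0, ← abs_mul]
    calc |r m * w| = |(r m * w + z) - z| := by ring_nf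
      _ ≤ |r m * w + z| + |z| := abs_sub _ _
      _ < M + 1 := by linarith [hη ▸ min_le_left 1 (ε / (4 * (|f'| + 1)))]
  have hwd : |w| < d := by
    rw [div_lt_iff₀ hd0] at hrd
    exact lt_of_mul_lt_mul_left (hrw.trans hrd) hr0.le
  have hrem := hd (y := v m ω) (by rwa [Real.dist_eq])
  rw [smul_eq_mul, Real.norm_eq_abs, Real.norm_eq_abs, ← hw] at hrem
  have h1 : r m * |f (v m ω) - f τ - w * f'| ≤ ε / 2 := by
    calc _ ≤ r m * (c * |w|) := by gcongr
      _ = c * (r m * |w|) := by ring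
      _ ≤ c * (M + 1) := by gcongr
      _ = ε / 2 := by rw [hc]; field_simp
  have h2 : |f'| * |r m * w + z| ≤ ε / 4 := by
    calc _ ≤ (|f'| + 1) * (ε / (4 * (|f'| + 1))) := by
          gcongr
          · linarith
          · exact hWω.le.trans (min_le_right _ _)
      _ = ε / 4 := by field_simp
  have h3 : r m * (f (v m ω) - f τ) + f' * z =
      r m * (f (v m ω) - f τ - w * f') + f' * (r m * w + z) := by ring
  have h4 := abs_add_le (r m * (f (v m ω) - f τ - w * f')) (f' * (r m * w + z))
  rw [abs_mul, abs_mul, abs_of_pos hr0] at h4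
  rw [h3] at hbad
  linarith

lemma tendstoInMeasure_zero_add {Ω : Type*} [MeasurableSpace Ω] {μ : Measure Ω}
    {X Y : ℕ → Ω → ℝ} (hX : TendstoInMeasure μ X atTop 0) (hY : TendstoInMeasure μ Y atTop 0) :
    TendstoInMeasure μ (fun m ω => X m ω + Y m ω) atTop 0 := by
  rw [tendstoInMeasure_iff_norm] at *
  intro ε hε
  have := (hX (ε / 2) (by positivity)).add (hY (ε / 2) (by positivity))
  rw [add_zero] at this
  refine tendsto_of_tendsto_of_tendsto_of_le_of_le tendsto_const_nhds this
    (fun _ => zero_le) fun m => (measure_mono fun ω hω => ?_).trans (measure_union_le _ _)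
  simp only [mem_union, mem_ofPred_eq, Pi.zero_apply, sub_zero] at hω ⊢
  by_contra! hc
  linarith [norm_add_le (X m ω) (Y m ω)]

lemma tendstoInMeasure_zero_of_abs_le {Ω : Type*} [MeasurableSpace Ω] {μ : Measure Ω}
    {X Y : ℕ → Ω → ℝ} (hX : TendstoInMeasure μ X atTop 0)
    (hXY : ∀ᶠ m in atTop, ∀ ω, |Y m ω| ≤ |X m ω|) :
    TendstoInMeasure μ Y atTop 0 := by
  rw [tendstoInMeasure_iff_norm] at *
  intro ε hε
  refine tendsto_of_tendsto_of_tendsto_of_le_of_le' tendsto_const_nhds (hX ε hε)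
    (Eventually.of_forall fun _ => zero_le) ?_
  filter_upwards [hXY] with m hm
  refine measure_mono fun ω hω => ?_
  simp only [mem_ofPred_eq, Pi.zero_apply, sub_zero, Real.norm_eq_abs] at hω ⊢
  exact hω.trans (hm ω)

lemma tendstoInMeasure_zero_const_mul {Ω : Type*} [MeasurableSpace Ω] {μ : Measure Ω}
    {X : ℕ → Ω → ℝ} (hX : TendstoInMeasure μ X atTop 0) (c : ℝ) :
    TendstoInMeasure μ (fun m ω => c * X m ω) atTop 0 := by
  rw [tendstoInMeasure_iff_norm] at *
  intro ε hε
  refine tendsto_of_tendsto_of_tendsto_of_le_of_le tendsto_const_nhds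
    (hX (ε / (|c| + 1)) (by positivity)) (fun _ => zero_le) fun m => measure_mono fun ω hω => ?_
  simp only [mem_ofPred_eq, Pi.zero_apply, sub_zero, Real.norm_eq_abs, abs_mul] at hω ⊢
  rw [div_le_iff₀ (by positivity)]
  nlinarith [abs_nonneg (X m ω)]

/-! ### Estimation error of the individual coefficients -/

/-- As `3 + δ > 2`, the rate relation makes even `n ^ 2 / T ^ κ` vanish. -/
lemma tendsto_mul_sqrt_div_rpow {n T : ℕ → ℕ} (hT : Tendsto T atTop atTop) {κ δ : ℝ} (hκ : 0 < κ)
    (hδ : 0 < δ) (hrate : (fun m => (n m : ℝ)) =o[atTop] fun m => (T m : ℝ) ^ (κ / (3 + δ))) :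
    Tendsto (fun m => √(n m : ℝ) * n m / (T m : ℝ) ^ κ) atTop (𝓝 0) := by
  have hq := (hrate.tendsto_div_nhds_zero).pow 2
  rw [zero_pow two_ne_zero] at hq
  refine tendsto_of_tendsto_of_tendsto_of_le_of_le' tendsto_const_nhds hq
    (Eventually.of_forall fun m => by positivity) ?_
  filter_upwards [hT.eventually_ge_atTop 1] with m hm
  have hT1 : (1 : ℝ) ≤ T m := by exact_mod_cast hm
  rw [div_pow, ← Real.rpow_mul_natCast (by positivity)]
  gcongr ?_ / ?_
  · rw [sq]
    gcongr
    rcases Nat.eq_zero_or_pos (n m) with h0 | h0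
    · simp [h0]
    · exact Real.sqrt_le_left (by positivity) |>.2 (by
        have : (1 : ℝ) ≤ n m := by exact_mod_cast h0
        nlinarith)
  · refine Real.rpow_le_rpow_of_exponent_le hT1 ?_
    rw [div_mul_eq_mul_div, div_le_iff₀ (by positivity)]
    push_cast
    nlinarith

/-- Markov's inequality for the sum of the errors of the first `n` individuals. -/
lemma tendstoInMeasure_sqrt_mul_sum {Ω : Type*} [MeasurableSpace Ω] {μ : Measure Ω}
    {d : ℕ → ℕ → Ω → ℝ} (hd0 : ∀ t i ω, 0 ≤ d t i ω) (hd : ∀ t i, AEMeasurable (d t i) μ)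
    {κ : ℝ} {T₀ : ℕ} {M : ℝ≥0}
    (hM : ∀ t, T₀ < t → ∀ i, ∫⁻ ω, ENNReal.ofReal ((t : ℝ) ^ κ * d t i ω) ∂μ ≤ M)
    {n T : ℕ → ℕ} (hT : Tendsto T atTop atTop)
    (hrate : Tendsto (fun m => √(n m : ℝ) * n m / (T m : ℝ) ^ κ) atTop (𝓝 0)) :
    TendstoInMeasure μ (fun m ω => √(n m : ℝ) * ∑ i ∈ Finset.range (n m), d (T m) i ω)
      atTop 0 := by
  rw [tendstoInMeasure_iff_norm]
  intro ε hε
  have hlim : Tendsto (fun m => ENNReal.ofReal (√(n m : ℝ) * n m / (T m : ℝ) ^ κ * (M / ε)))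
      atTop (𝓝 0) := by
    rw [← ENNReal.ofReal_zero]
    exact ENNReal.tendsto_ofReal (by simpa using hrate.mul_const (M / ε))
  refine tendsto_of_tendsto_of_tendsto_of_le_of_le' tendsto_const_nhds hlim
    (Eventually.of_forall fun _ => zero_le) ?_
  filter_upwards [hT.eventually_gt_atTop T₀] with m hm
  have hT0 : (0 : ℝ) < T m := by exact_mod_cast (Nat.zero_le _).trans_lt hm
  set t := (T m : ℝ) ^ κ
  have ht0 : 0 < t := by positivity
  set F : Ω → ℝ≥0∞ := fun ω =>
    ENNReal.ofReal √(n m : ℝ) * ∑ i ∈ Finset.range (n m), ENNReal.ofReal (t * d (T m) i ω)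
  have hFm : ∀ i, AEMeasurable (fun ω => ENNReal.ofReal (t * d (T m) i ω)) μ := fun i =>
    ((hd (T m) i).const_mul t).ennreal_ofReal
  have hFint : ∫⁻ ω, F ω ∂μ ≤ ENNReal.ofReal (√(n m : ℝ) * n m * M) := by
    rw [lintegral_const_mul'' _ (Finset.aemeasurable_fun_sum _ fun i _ => hFm i),
      lintegral_finsetSum' _ fun i _ => hFm i]
    calc _ ≤ ENNReal.ofReal √(n m : ℝ) * ∑ i ∈ Finset.range (n m), (M : ℝ≥0∞) := by
          gcongr with i
          exact hM _ hm i
      _ = _ := by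
          rw [mul_assoc, ENNReal.ofReal_mul (by positivity), ENNReal.ofReal_mul (by positivity)]
          simp
  have hmarkov := mul_meas_ge_le_lintegral₀
    ((Finset.aemeasurable_fun_sum (Finset.range (n m)) fun i _ => hFm i).const_mul
      (ENNReal.ofReal √(n m : ℝ))) (ENNReal.ofReal (ε * t))
  have hsub : {ω | ε ≤ ‖√(n m : ℝ) * ∑ i ∈ Finset.range (n m), d (T m) i ω - (0 : Ω → ℝ) ω‖} ⊆
      {ω | ENNReal.ofReal (ε * t) ≤ F ω} := by
    intro ω hω
    have hs : 0 ≤ ∑ i ∈ Finset.range (n m), d (T m) i ω := Finset.sum_nonneg fun i _ => hd0 _ _ _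
    simp only [mem_ofPred_eq, Pi.zero_apply, sub_zero, Real.norm_eq_abs,
      abs_of_nonneg (mul_nonneg (Real.sqrt_nonneg _) hs)] at hω ⊢
    simp only [F]
    rw [← ENNReal.ofReal_sum_of_nonneg fun i _ => mul_nonneg ht0.le (hd0 _ _ _),
      ← ENNReal.ofReal_mul (by positivity), ← Finset.mul_sum]
    refine ENNReal.ofReal_le_ofReal ?_
    calc ε * t ≤ _ := mul_le_mul_of_nonneg_right hω ht0.le
      _ = _ := by ring
  have key : ENNReal.ofReal (ε * t) *
      μ {ω | ε ≤ ‖√(n m : ℝ) * ∑ i ∈ Finset.range (n m), d (T m) i ω - (0 : Ω → ℝ) ω‖} ≤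
      ENNReal.ofReal (√(n m : ℝ) * n m * M) :=
    (mul_le_mul_right (measure_mono hsub) _).trans (hmarkov.trans hFint)
  rw [mul_comm] at key
  rw [← ENNReal.le_div_iff_mul_le (Or.inl (ENNReal.ofReal_pos.2 (by positivity)).ne')
    (Or.inl ENNReal.ofReal_ne_top),
    ← ENNReal.ofReal_div_of_pos (by positivity)] at key
  refine key.trans (ENNReal.ofReal_le_ofReal (le_of_eq ?_))
  field_simp

/-! ### Measurability of the estimators -/

lemma measurable_matrix_inv_apply {K : ℕ} (i j : Fin K) :
    Measurable fun M : Fin K → Fin K → ℝ => ((Matrix.of M)⁻¹ : Matrix (Fin K) (Fin K) ℝ) i j := by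
  have hdet : Continuous fun M : Fin K → Fin K → ℝ => (Matrix.of M).det :=
    Continuous.matrix_det continuous_id
  have hadj : Continuous fun M : Fin K → Fin K → ℝ => (Matrix.of M).adjugate i j :=
    (Continuous.matrix_adjugate (A := fun M : Fin K → Fin K → ℝ => Matrix.of M)
      continuous_id).matrix_elem i j
  simp only [Matrix.inv_def, Ring.inverse_eq_inv', Matrix.smul_apply, smul_eq_mul]
  exact hdet.measurable.inv.mul hadj.measurable

lemma measurable_tsOLS {Ω : Type*} [MeasurableSpace Ω] {K : ℕ} {X : ℕ → ℕ → Ω → Fin K → ℝ}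
    {Y : ℕ → ℕ → Ω → ℝ} (hX : ∀ i t, Measurable (X i t)) (hY : ∀ i t, Measurable (Y i t))
    (T i : ℕ) : Measurable (tsOLS X Y T i) := by
  have hXa : ∀ t a, Measurable fun ω => X i t ω a := fun t a =>
    (measurable_pi_apply a).comp (hX i t)
  have hgram : Measurable fun ω => (fun a b : Fin K =>
      ((T : ℝ)⁻¹ • ∑ t ∈ Finset.range T, Matrix.vecMulVec (X i t ω) (X i t ω)) a b) := by
    refine measurable_pi_lambda _ fun a => measurable_pi_lambda _ fun b => ?_
    simp only [Matrix.smul_apply, Matrix.sum_apply, Matrix.vecMulVec_apply, smul_eq_mul]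
    exact (Finset.measurable_fun_sum _ fun t _ => (hXa t a).mul (hXa t b)).const_mul _
  refine measurable_pi_lambda _ fun a => ?_
  simp only [tsOLS, Matrix.mulVec, dotProduct]
  refine Finset.measurable_fun_sum _ fun b _ =>
    ((measurable_matrix_inv_apply a b).comp hgram).mul ?_
  simp only [Pi.smul_apply, Finset.sum_apply, smul_eq_mul]
  exact (Finset.measurable_fun_sum _ fun t _ => (hY i t).mul (hXa t b)).const_mul _

lemma measurable_rankEstimator {Ω : Type*} [MeasurableSpace Ω] {K : ℕ}
    {X : ℕ → ℕ → Ω → Fin K → ℝ} {Y : ℕ → ℕ → Ω → ℝ} {xstar : Fin K → ℝ}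
    (hX : ∀ i t, Measurable (X i t)) (hY : ∀ i t, Measurable (Y i t))
    {σ : (n : ℕ) → ℕ → Ω → Equiv.Perm (Fin n)} (hσ : IsEstimatedPermutation X Y xstar σ)
    (n T : ℕ) (τ : ℝ) : Measurable (rankEstimator X Y σ n T τ) := by
  unfold rankEstimator
  split_ifs with h
  · intro s hs
    have : (fun ω => tsOLS X Y T (σ n T ω ⟨⌈(n : ℝ) * τ⌉₊ - 1, h⟩ : Fin n) ω) ⁻¹' s =
        ⋃ p : Equiv.Perm (Fin n), {ω | σ n T ω = p} ∩
          tsOLS X Y T (p ⟨⌈(n : ℝ) * τ⌉₊ - 1, h⟩ : Fin n) ⁻¹' s := by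
      ext ω
      simp
    rw [this]
    exact MeasurableSet.iUnion fun p => (hσ.measurable n T p).inter (measurable_tsOLS hX hY T _ hs)
  · exact measurable_const

lemma IIDUniformRanks.aemeasurable_comp {Ω : Type*} [MeasurableSpace Ω] {μ : Measure Ω}
    {U : ℕ → Ω → ℝ} (h : IIDUniformRanks μ U) {K : ℕ} {f : ℝ → Fin K → ℝ}
    (hf : ContinuousOn f (Ioo 0 1)) (i : ℕ) : AEMeasurable (fun ω => f (U i ω)) μ := by
  refine AEMeasurable.comp_aemeasurable (g := f) ?_ (h.aemeasurable i)
  rw [h.map_eq]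
  exact hf.aemeasurable measurableSet_Ioo

/-! ### The selected individual has an approximate quantile rank -/

lemma ceil_mul_sub_one_lt {n : ℕ} (hn : 0 < n) {τ : ℝ} (hτ : τ ∈ Ioo (0 : ℝ) 1) :
    ⌈(n : ℝ) * τ⌉₊ - 1 < n := by
  have hn' : (0 : ℝ) < n := by exact_mod_cast hn
  have : ⌈(n : ℝ) * τ⌉₊ ≤ n := Nat.ceil_le.2 (by nlinarith [hτ.2])
  omega

/-- If the points `u i` are sorted by approximations `y i` of `g (u i)` and `g` has slope at least
`L > 0`, then the point in position `⌈n τ⌉` is an approximate `τ`-quantile. -/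
lemma isApproxQuantile_of_monotone {n : ℕ} (hn : 0 < n) {u y : ℕ → ℝ} {g : ℝ → ℝ} {L : ℝ}
    (hL : 0 < L) (hu : ∀ i, u i ∈ Ioo (0 : ℝ) 1)
    (hg : ∀ a ∈ Ioo (0 : ℝ) 1, ∀ b ∈ Ioo (0 : ℝ) 1, a ≤ b → L * (b - a) ≤ g b - g a)
    (σ : Equiv.Perm (Fin n)) (hσ : Monotone fun j => y (σ j)) {D : ℝ} (hD : 0 ≤ D)
    (hy : ∀ i : Fin n, |y i - g (u i)| ≤ D) {τ : ℝ} (hτ : τ ∈ Ioo (0 : ℝ) 1)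
    (h : ⌈(n : ℝ) * τ⌉₊ - 1 < n) :
    IsApproxQuantile n u τ (u (σ ⟨⌈(n : ℝ) * τ⌉₊ - 1, h⟩)) (2 * D / L) := by
  have hn' : (0 : ℝ) < n := by exact_mod_cast hn
  have hpos : 0 < (n : ℝ) * τ := mul_pos hn' hτ.1
  have hcast : ((⌈(n : ℝ) * τ⌉₊ - 1 : ℕ) : ℝ) = ⌈(n : ℝ) * τ⌉₊ - 1 := by
    rw [Nat.cast_sub (Nat.ceil_pos.2 hpos)]
    simp
  have key : ∀ i j : Fin n, y i ≤ y j → u i ≤ u j + 2 * D / L := by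
    intro i j hij
    rcases le_total (u i) (u j) with hle | hle
    · have : 0 ≤ 2 * D / L := by positivity
      linarith
    · have h1 := hg _ (hu j) _ (hu i) hle
      have h2 := (abs_le.1 (hy i)).1
      have h3 := (abs_le.1 (hy j)).2
      have : u i - u j ≤ 2 * D / L := by
        rw [le_div_iff₀ hL]
        linarith
      linarith
  set p : Fin n := ⟨⌈(n : ℝ) * τ⌉₊ - 1, h⟩
  have hpv : (p : ℝ) = ⌈(n : ℝ) * τ⌉₊ - 1 := hcast
  constructor
  · intro b hb
    have := le_sum_indicator_Iic (u := u) σ p (b := b) fun j hj => (key _ _ (hσ hj)).trans hb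
    linarith [Nat.le_ceil ((n : ℝ) * τ)]
  · intro a ha
    have := sum_indicator_Iic_le (u := u) σ p (a := a) fun j hj => by
      linarith [key _ _ (hσ hj)]
    linarith [Nat.ceil_lt_add_one hpos.le]

lemma abs_dotProduct_le {K : ℕ} (x w : Fin K → ℝ) : |x ⬝ᵥ w| ≤ (∑ k, |x k|) * ‖w‖ := by
  rw [dotProduct, Finset.sum_mul]
  refine (Finset.abs_sum_le_sum_abs _ _).trans (Finset.sum_le_sum fun k _ => ?_)
  rw [abs_mul]
  gcongr
  exact norm_le_pi_norm w k

/-! ### Gaussian limits -/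

lemma hasLaw_const_mul_gaussianReal_zero {Ω : Type*} [MeasurableSpace Ω] {P : Measure Ω}
    {Z : Ω → ℝ} {v : ℝ} (h : HasLaw Z (gaussianReal 0 v.toNNReal) P) (hv : 0 ≤ v) (c : ℝ) :
    HasLaw (fun ω => c * Z ω) (gaussianReal 0 (v * c ^ 2).toNNReal) P := by
  have hvar : (v * c ^ 2).toNNReal = .mk (c ^ 2) (sq_nonneg c) * v.toNNReal := by
    ext
    simp [Real.coe_toNNReal _ hv, Real.coe_toNNReal _ (mul_nonneg hv (sq_nonneg c)), mul_comm]
  rw [hvar]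
  simpa using gaussianReal_const_mul h c

lemma IsStandardBrownianBridge.hasLaw_const_mul {Ω : Type*} [MeasurableSpace Ω] {P : Measure Ω}
    {G : Icc (0 : ℝ) 1 → Ω → ℝ} (h : IsStandardBrownianBridge G P) (u : Icc (0 : ℝ) 1) (c : ℝ) :
    HasLaw (fun ω => c * G u ω) (gaussianReal 0 ((u : ℝ) * (1 - u) * c ^ 2).toNNReal) P := by
  have hG := h.gaussian.hasGaussianLaw_eval u
  have hlaw : HasLaw (G u) (gaussianReal 0 ((u : ℝ) * (1 - u)).toNNReal) P := by
    refine ⟨hG.aemeasurable, ?_⟩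
    rw [hG.map_eq_gaussianReal, h.mean_zero u, ← covariance_self hG.aemeasurable, h.cov u u]
    congr 2
    rw [min_self]
    ring
  exact hasLaw_const_mul_gaussianReal_zero hlaw (mul_nonneg u.2.1 (sub_nonneg.2 u.2.2)) c

/-- Convergence in distribution depends on the limit only through its law. -/
lemma tendstoInDistribution_of_hasLaw {Ω Ω₁ Ω₂ : Type*} [MeasurableSpace Ω] [MeasurableSpace Ω₁]
    [MeasurableSpace Ω₂] {μ : Measure Ω} [IsProbabilityMeasure μ] {P₁ : Measure Ω₁}
    [IsProbabilityMeasure P₁] {P₂ : Measure Ω₂} [IsProbabilityMeasure P₂] {W : ℕ → Ω → ℝ}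
    {Z₁ : Ω₁ → ℝ} {Z₂ : Ω₂ → ℝ} {ν : Measure ℝ}
    (h : TendstoInDistribution W atTop Z₁ (fun _ => μ) P₁)
    (h₁ : HasLaw Z₁ ν P₁) (h₂ : HasLaw Z₂ ν P₂) :
    TendstoInDistribution W atTop Z₂ (fun _ => μ) P₂ where
  forall_aemeasurable := h.forall_aemeasurable
  aemeasurable_limit := h₂.aemeasurable
  tendsto := by
    have := h.tendsto
    simp only [h₁.map_eq] at this
    simp only [h₂.map_eq]
    exact this

/-! ### Asymptotic linearity and normality of the rank estimator -/

/-- The rank estimator is asymptotically linear: its scaled error is `-β_k'(τ)` times the empirical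
process of the ranks at `τ`, up to a term that vanishes in probability. -/
theorem tendstoInMeasure_rankEstimator_add {Ω : Type*} [MeasurableSpace Ω] {μ : Measure Ω}
    [IsProbabilityMeasure μ] {K : ℕ} {X : ℕ → ℕ → Ω → Fin K → ℝ} {Y : ℕ → ℕ → Ω → ℝ}
    {U : ℕ → Ω → ℝ} {β : ℝ → Fin K → ℝ} {xstar : Fin K → ℝ} (hrank : IIDUniformRanks μ U)
    {L : ℝ} (hL : 0 < L)
    (hderiv : ∀ u ∈ Ioo (0 : ℝ) 1, DifferentiableAt ℝ (fun u => xstar ⬝ᵥ β u) u ∧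
      L ≤ deriv (fun u => xstar ⬝ᵥ β u) u)
    {n T : ℕ → ℕ} (hn : Tendsto n atTop atTop)
    (hsum : TendstoInMeasure μ (fun m ω => √(n m : ℝ) *
      ∑ i ∈ Finset.range (n m), ‖tsOLS X Y (T m) i ω - β (U i ω)‖) atTop 0)
    {σ : (n : ℕ) → ℕ → Ω → Equiv.Perm (Fin n)} (hσ : IsEstimatedPermutation X Y xstar σ)
    {τ : ℝ} (hτ : τ ∈ Ioo (0 : ℝ) 1) {k : Fin K} {b : ℝ}
    (hb : HasDerivAt (fun u => β u k) b τ) :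
    TendstoInMeasure μ (fun m ω =>
      √(n m : ℝ) * (rankEstimator X Y σ (n m) (T m) τ ω k - β τ k) +
        b * empiricalDeviation (n m) (fun i => U i ω) τ) atTop 0 := by
  set D : ℕ → Ω → ℝ := fun m ω => ∑ i ∈ Finset.range (n m), ‖tsOLS X Y (T m) i ω - β (U i ω)‖
  have hD0 : ∀ m ω, 0 ≤ D m ω := fun m ω => Finset.sum_nonneg fun _ _ => norm_nonneg _
  have hdD : ∀ m ω (i : Fin (n m)), ‖tsOLS X Y (T m) i ω - β (U i ω)‖ ≤ D m ω := fun m ω i =>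
    Finset.single_le_sum (f := fun i : ℕ => ‖tsOLS X Y (T m) i ω - β (U i ω)‖)
      (fun _ _ => norm_nonneg _) (Finset.mem_range.2 i.2)
  set C := ∑ l, |xstar l|
  have hC0 : 0 ≤ C := Finset.sum_nonneg fun _ _ => abs_nonneg _
  -- the index of the selected individual; its value `0` for an empty sample plays no role
  let S : ℕ → Ω → ℕ := fun m ω =>
    if h : ⌈(n m : ℝ) * τ⌉₊ - 1 < n m then (σ (n m) (T m) ω ⟨⌈(n m : ℝ) * τ⌉₊ - 1, h⟩ : ℕ) else 0
  have hslope : ∀ x ∈ Ioo (0 : ℝ) 1, ∀ y ∈ Ioo (0 : ℝ) 1, x ≤ y →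
      L * (y - x) ≤ xstar ⬝ᵥ β y - xstar ⬝ᵥ β x :=
    Convex.mul_sub_le_image_sub_of_le_deriv (convex_Ioo 0 1)
      (fun u hu => (hderiv u hu).1.continuousAt.continuousWithinAt)
      (fun u hu => (hderiv u (interior_subset hu)).1.differentiableWithinAt)
      (fun u hu => (hderiv u (interior_subset hu)).2)
  have hq : ∀ m, 0 < n m → ∀ᵐ ω ∂μ,
      IsApproxQuantile (n m) (fun i => U i ω) τ (U (S m ω) ω) (2 * C / L * D m ω) := by
    intro m hm
    have hlt := ceil_mul_sub_one_lt hm hτ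
    filter_upwards [ae_all_iff.2 hrank.ae_mem] with ω hω
    have := isApproxQuantile_of_monotone hm (u := fun i => U i ω)
      (y := fun i => fittedOutcome X Y xstar (T m) i ω) hL hω hslope (σ (n m) (T m) ω)
      (hσ.sorted (n m) (T m) ω) (D := C * D m ω) (mul_nonneg hC0 (hD0 m ω)) (fun i => by
        rw [fittedOutcome, ← dotProduct_sub]
        exact (abs_dotProduct_le _ _).trans (mul_le_mul_of_nonneg_left (hdD m ω i) hC0)) hτ hlt
    simp only [S, dif_pos hlt]
    convert this using 1
    ring
  have he : TendstoInMeasure μ (fun m ω => √(n m : ℝ) * (2 * C / L * D m ω)) atTop 0 := by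
    convert! tendstoInMeasure_zero_const_mul hsum (2 * C / L) using 3
    ring
  have hdelta := tendstoInMeasure_delta (tendsto_sqrt_natCast_atTop hn)
    (v := fun m ω => U (S m ω) ω) hb
    (fun ρ hρ => (hrank.exists_forall_measure_le hτ hρ).imp fun M hM => ⟨hM.1, fun m => hM.2 (n m)⟩)
    (hrank.tendstoInMeasure_approxQuantile hn hτ hq he)
  have herr : TendstoInMeasure μ (fun m ω => √(n m : ℝ) *
      (rankEstimator X Y σ (n m) (T m) τ ω k - β (U (S m ω) ω) k)) atTop 0 := by
    refine tendstoInMeasure_zero_of_abs_le hsum ?_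
    filter_upwards [hn.eventually_gt_atTop 0] with m hm ω
    have hlt := ceil_mul_sub_one_lt hm hτ
    simp only [rankEstimator, S, dif_pos hlt]
    rw [abs_mul, abs_mul]
    refine mul_le_mul_of_nonneg_left ?_ (abs_nonneg _)
    exact ((norm_le_pi_norm (tsOLS X Y (T m) _ ω - β (U _ ω)) k).trans (hdD m ω _)).trans
      (le_abs_self _)
  convert! tendstoInMeasure_zero_add herr hdelta using 3
  ring

/-- An asymptotically linear statistic with influence `-b` on the empirical process at `τ` inherits
its normal limit, by Slutsky's theorem. -/
lemma tendstoInDistribution_of_add_empiricalDeviation {Ω : Type*} [MeasurableSpace Ω]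
    {μ : Measure Ω} [IsProbabilityMeasure μ] {U : ℕ → Ω → ℝ} (hrank : IIDUniformRanks μ U)
    {n : ℕ → ℕ} (hn : Tendsto n atTop atTop) {τ : ℝ} (hτ : τ ∈ Ioo (0 : ℝ) 1) {b : ℝ}
    {W : ℕ → Ω → ℝ} (hW : ∀ m, AEMeasurable (W m) μ)
    (hlin : TendstoInMeasure μ
      (fun m ω => W m ω + b * empiricalDeviation (n m) (fun i => U i ω) τ) atTop 0) :
    TendstoInDistribution W atTop (id : ℝ → ℝ) (fun _ => μ)
      (gaussianReal 0 (τ * (1 - τ) * b ^ 2).toNNReal) := by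
  have hid : ∀ v : ℝ≥0, HasLaw (id : ℝ → ℝ) (gaussianReal 0 v) (gaussianReal 0 v) := fun v =>
    HasLaw.id
  have hclt := (hrank.tendstoInDistribution_empiricalDeviation hτ (hid _)).continuous_comp
    (g := fun x => -b * x) (by fun_prop)
  have hclt' : TendstoInDistribution
      (fun m ω => -b * empiricalDeviation (n m) (fun i => U i ω) τ) atTop (fun x : ℝ => -b * x)
      (fun _ => μ) (gaussianReal 0 (τ * (1 - τ)).toNNReal) :=
    ⟨fun m => hclt.forall_aemeasurable (n m), hclt.aemeasurable_limit, hclt.tendsto.comp hn⟩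
  have hlaw : HasLaw (fun x : ℝ => -b * x) (gaussianReal 0 (τ * (1 - τ) * b ^ 2).toNNReal)
      (gaussianReal 0 (τ * (1 - τ)).toNNReal) := by
    simpa using hasLaw_const_mul_gaussianReal_zero (hid (τ * (1 - τ)).toNNReal)
      (mul_nonneg hτ.1.le (sub_nonneg.2 hτ.2.le)) (-b)
  refine tendstoInDistribution_of_hasLaw
    (tendstoInDistribution_of_tendstoInMeasure_sub W _ hclt' ?_ hW) hlaw (hid _)
  convert! hlin using 3
  simp [sub_eq_add_neg]

end PanelQuantile

theorem corollary5
    {Ω : Type*} [MeasurableSpace Ω] (μ : Measure Ω) [IsProbabilityMeasure μ]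
    {K : ℕ}
    -- data, ranks, coefficient function, and the model `Y = X'β(U) + V`
    (X : ℕ → ℕ → Ω → Fin K → ℝ) (Y V : ℕ → ℕ → Ω → ℝ) (U : ℕ → Ω → ℝ)
    (β : ℝ → Fin K → ℝ) (xstar : Fin K → ℝ)
    (hX : ∀ i t, Measurable (X i t)) (hY : ∀ i t, Measurable (Y i t))
    (hV : ∀ i t, Measurable (V i t)) (hU : ∀ i, Measurable (U i))
    (hmodel : ∀ i t, ∀ᵐ ω ∂μ, Y i t ω = X i t ω ⬝ᵥ β (U i ω) + V i t ω)
    -- iid sampling, iid uniform ranks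
    (hiid : PanelQuantile.IIDObservables μ X Y)
    (hrank : PanelQuantile.IIDUniformRanks μ U)
    -- monotonicity and continuity at `x*`
    (hsupp : ∀ i, ∃ t, xstar ∈ (μ.map (X i t)).support)
    (hmono : StrictMonoOn (fun u => xstar ⬝ᵥ β u) (Icc 0 1))
    (hcont : ContinuousOn (fun u => xstar ⬝ᵥ β u) (Ioo 0 1))
    -- individual slope identification
    {𝒜 : Type*} [MeasurableSpace 𝒜] (A : ℕ → Ω → 𝒜) (hA : ∀ i, Measurable (A i))
    (hident : PanelQuantile.IndividualSlopeIdentification μ X V U β A)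
    -- uniform continuity, extended monotonicity
    (huc : ∀ k, UniformContinuousOn (fun u => β u k) (Ioo 0 1))
    (L : ℝ) (hL : 0 < L)
    (hderiv : ∀ u ∈ Ioo (0 : ℝ) 1, DifferentiableAt ℝ (fun u => xstar ⬝ᵥ β u) u ∧
      L ≤ deriv (fun u => xstar ⬝ᵥ β u) u)
    -- moment bound for the individual OLS estimators
    (κ : ℝ) (hκ : 0 < κ)
    (hmoment : PanelQuantile.OLSMomentBound μ X Y U β κ)
    -- smoothness of the coefficient functions
    (hsmooth : ∀ k, PanelQuantile.HasUnifContBddDeriv (fun u => β u k))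
    -- the sample sizes, their rate relation, and uniform consistency of OLS along them
    (n T : ℕ → ℕ) (hn : Tendsto n atTop atTop) (hT : Tendsto T atTop atTop)
    (δ : ℝ) (hδ : 0 < δ)
    (hrate : (fun m => (n m : ℝ)) =o[atTop] fun m => (T m : ℝ) ^ (κ / (3 + δ)))
    (hcons : PanelQuantile.OLSUniformConsistency μ X Y U β n T)
    -- the estimated permutation
    (σ : (n : ℕ) → ℕ → Ω → Equiv.Perm (Fin n))
    (hσ : PanelQuantile.IsEstimatedPermutation X Y xstar σ)
    (τ : ℝ) (hτ : τ ∈ Ioo (0 : ℝ) 1) (k : Fin K) :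
    TendstoInDistribution
      (fun m ω => √(n m : ℝ) *
        (PanelQuantile.rankEstimator X Y σ (n m) (T m) τ ω k - β τ k))
      atTop (id : ℝ → ℝ) (fun _ => μ)
      (gaussianReal 0 (τ * (1 - τ) * deriv (fun u => β u k) τ ^ 2).toNNReal) ∧
    ∀ {Ω' : Type*} [MeasurableSpace Ω'] (P : Measure Ω') [IsProbabilityMeasure P]
      (G : Icc (0 : ℝ) 1 → Ω' → ℝ), PanelQuantile.IsStandardBrownianBridge G P →
      TendstoInDistribution
        (fun m ω => √(n m : ℝ) *
          (PanelQuantile.rankEstimator X Y σ (n m) (T m) τ ω k - β τ k))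
        atTop (fun ω' => deriv (fun u => β u k) τ * G ⟨τ, Ioo_subset_Icc_self hτ⟩ ω')
        (fun _ => μ) P ∧
      HasLaw (fun ω' => deriv (fun u => β u k) τ * G ⟨τ, Ioo_subset_Icc_self hτ⟩ ω')
        (gaussianReal 0 (τ * (1 - τ) * deriv (fun u => β u k) τ ^ 2).toNNReal) P := by
  have hcontβ : ContinuousOn β (Ioo 0 1) := continuousOn_pi.2 fun l => (huc l).continuousOn
  have hb : HasDerivAt (fun u => β u k) (deriv (fun u => β u k) τ) τ :=
    ((hsmooth k).1 τ hτ).hasDerivAt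
  obtain ⟨T₀, M, hM⟩ := hmoment
  have hsum := PanelQuantile.tendstoInMeasure_sqrt_mul_sum
    (d := fun t i ω => ‖PanelQuantile.tsOLS X Y t i ω - β (U i ω)‖)
    (fun _ _ _ => norm_nonneg _)
    (fun t i => ((PanelQuantile.measurable_tsOLS hX hY t i).aemeasurable.sub
      (hrank.aemeasurable_comp hcontβ i)).norm) hM hT
    (PanelQuantile.tendsto_mul_sqrt_div_rpow hT hκ hδ hrate)
  have hlin := PanelQuantile.tendstoInMeasure_rankEstimator_add hrank hL hderiv hn hsum hσ hτ hb
  have hmain := PanelQuantile.tendstoInDistribution_of_add_empiricalDeviation hrank hn hτ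
    (fun m => ((((measurable_pi_apply k).comp
      (PanelQuantile.measurable_rankEstimator hX hY hσ (n m) (T m) τ)).sub_const _).const_mul
        _).aemeasurable) hlin
  refine ⟨hmain, fun P _ G hG => ?_⟩
  have hlaw := hG.hasLaw_const_mul ⟨τ, Ioo_subset_Icc_self hτ⟩ (deriv (fun u => β u k) τ)
  exact ⟨PanelQuantile.tendstoInDistribution_of_hasLaw hmain HasLaw.id hlaw, hlaw⟩
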